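/- **Theorem (Excision for closure spaces).** A (Čech) closure space is a set $X$ with an operator $c:2^X\to 2^X$ such that $c(\varnothing)=\varnothing$, $A\subset c(A)$ and $c(A\cup B)=c(A)\cup c(B)$ for all $A,B\subset X$; its interior operator is $i(A)=X\setminus c(X\setminus A)$. A map $f:(X,c)\to(Y,d)$ is continuous if $f(c(A))\subset d(f(A))$ for all $A\subset X$, and a subset $S\subset X$ carries the subspace closure $c_S(B)=S\cap c(B)$. An interior cover of $X$ is a family of subsets covering $X$ such that every $x\in X$ lies in $i(U)$ for some member $U$. Let $C_n(X)$ be the free abelian group on the continuous maps $\sigma:|\Delta^n|\to X$ from the standard topological $n$-simplex, with boundary $\partial\sigma=\sum_{i=0}^n(-1)^i\sigma|_{[e_0,\dots,\hat e_i,\dots,e_n]}$ for $n\ge 1$ and $\partial=0$ on $C_0(X)$. For $A\subset X$ with the subspace closure let $H_n(X,A)$ be the $n$-th homology group of the quotient complex $C_\bullet(X)/C_\bullet(A)$ (extended by zero to negative degrees). 1. If $\{A,B\}$ is an interior cover of a closure space $X$, then for all $n\in\mathbb Z$ the inclusion $(B,A\cap B)\to(X,A)$ induces an isomorphism $H_n(B,A\cap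 B)\cong H_n(X,A)$. 2. Equivalently, if $Z\subset A\subset X$ and $c(Z)\subset i(A)$, then for all $n\in\mathbb Z$ the inclusion $(X\setminus Z,A\setminus Z)\to(X,A)$ induces an isomorphism $H_n(X\setminus Z,A\setminus Z)\cong H_n(X,A)$. -/

import Mathlib

open CategoryTheory

universe u v

/-- A Čech closure space: a set `X` with a closure operator `cl : 2^X → 2^X`
(not assumed to be idempotent). -/
class ClosureSpace (X : Type u) where
  cl : Set X → Set X
  cl_empty : cl ∅ = ∅
  subset_cl : ∀ A : Set X, A ⊆ cl A
  cl_union : ∀ A B : Set X, cl (A ∪ B) = cl A ∪ cl B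

namespace ClosureSpace

theorem cl_mono {X : Type u} [ClosureSpace X] {A B : Set X} (h : A ⊆ B) : cl A ⊆ cl B := by
  have h1 : cl B = cl A ∪ cl B := by rw [← cl_union, Set.union_eq_self_of_subset_left h]
  rw [h1]
  exact Set.subset_union_left

/-- The interior operator `i(A) = X \ c(X \ A)`. -/
def int {X : Type u} [ClosureSpace X] (A : Set X) : Set X := (cl Aᶜ)ᶜ

/-- `U` is a neighbourhood of the point `x`. -/
def IsNhd {X : Type u} [ClosureSpace X] (U : Set X) (x : X) : Prop := x ∈ int U

/-- A family of subsets of `X` is an interior cover if it covers `X` and every point of `X` has a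
neighbourhood belonging to the family. -/
def IsInteriorCover {X : Type u} [ClosureSpace X] (𝒰 : Set (Set X)) : Prop :=
  ⋃₀ 𝒰 = Set.univ ∧ ∀ x : X, ∃ U ∈ 𝒰, IsNhd U x

/-- A map of closure spaces is continuous if `f (c A) ⊆ d (f A)` for all `A`. -/
def IsCont {X : Type u} {Y : Type v} [ClosureSpace X] [ClosureSpace Y] (f : X → Y) : Prop :=
  ∀ A : Set X, f '' cl A ⊆ cl (f '' A)

theorem IsCont.comp {X Y Z : Type*} [ClosureSpace X] [ClosureSpace Y] [ClosureSpace Z]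
    {g : Y → Z} {f : X → Y} (hg : IsCont g) (hf : IsCont f) : IsCont (g ∘ f) := by
  intro A
  rw [Set.image_comp, Set.image_comp]
  exact (Set.image_mono (hf A)).trans (hg _)

/-- The topological closure operator of a topological space. -/
abbrev ofTopology (X : Type u) [TopologicalSpace X] : ClosureSpace X where
  cl := closure
  cl_empty := closure_empty
  subset_cl _ := subset_closure
  cl_union _ _ := closure_union

/-- The subspace closure operator `c_S(B) = S ∩ c(B)` on `S ⊆ X`. -/
instance subspace {X : Type u} [ClosureSpace X] (S : Set X) : ClosureSpace S where
  cl B := Subtype.val ⁻¹' cl (Subtype.val '' B)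
  cl_empty := by rw [Set.image_empty, cl_empty, Set.preimage_empty]
  subset_cl B := Set.image_subset_iff.1 (subset_cl _)
  cl_union A B := by rw [Set.image_union, cl_union, Set.preimage_union]

theorem isCont_val {X : Type u} [ClosureSpace X] (S : Set X) :
    IsCont (Subtype.val : S → X) := by
  intro A
  exact Set.image_subset_iff.2 (Set.Subset.refl _)

/-- The standard `n`-simplex `{t ∈ ℝ^(n+1) | ∑ tᵢ = 1, tᵢ ≥ 0}`, as a closure space through
its topology. -/
instance simplex (n : ℕ) : ClosureSpace (stdSimplex ℝ (Fin (n + 1))) := ofTopology _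

/-- The `i`-th face inclusion of standard simplices: the affine map that sends the vertices
`e_0, …, e_n` in order to `e_0, …, ê_i, …, e_{n+1}`. -/
noncomputable def faceMap {n : ℕ} (i : Fin (n + 2)) :
    stdSimplex ℝ (Fin (n + 1)) → stdSimplex ℝ (Fin (n + 2)) :=
  stdSimplex.map i.succAbove

theorem isCont_faceMap {n : ℕ} (i : Fin (n + 2)) : IsCont (faceMap i) := by
  intro A
  exact image_closure_subset_closure_image (stdSimplex.continuous_map _)

/-- Singular `n`-simplices of a closure space: continuous maps from the standard `n`-simplex. -/
@[ext]
structure SingularSimplex (X : Type u) [ClosureSpace X] (n : ℕ) where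
  toFun : stdSimplex ℝ (Fin (n + 1)) → X
  cont : IsCont toFun

/-- The `i`-th face of a singular simplex. -/
noncomputable def SingularSimplex.face {X : Type u} [ClosureSpace X] {n : ℕ}
    (σ : SingularSimplex X (n + 1)) (i : Fin (n + 2)) : SingularSimplex X n where
  toFun := σ.toFun ∘ faceMap i
  cont := σ.cont.comp (isCont_faceMap i)

/-- The singular simplex `f ∘ σ`. -/
def SingularSimplex.push {X : Type u} {Y : Type v} [ClosureSpace X] [ClosureSpace Y] {n : ℕ}
    (σ : SingularSimplex X n) (f : X → Y) (hf : IsCont f) : SingularSimplex Y n where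
  toFun := f ∘ σ.toFun
  cont := hf.comp σ.cont

/-- The group `C_n(X)` of singular `n`-chains: the free abelian group on the singular
`n`-simplices. -/
abbrev Chains (X : Type u) [ClosureSpace X] (n : ℕ) : Type u := SingularSimplex X n →₀ ℤ

/-- The boundary map: `∂σ = ∑ᵢ (-1)^i σ|[e_0, …, ê_i, …, e_{n+1}]` on a singular `(n+1)`-simplex,
extended linearly. -/
noncomputable def boundary (X : Type u) [ClosureSpace X] (n : ℕ) :
    Chains X (n + 1) →ₗ[ℤ] Chains X n :=
  Finsupp.linearCombination ℤ fun σ : SingularSimplex X (n + 1) =>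
    ∑ i : Fin (n + 2), (-1 : ℤ) ^ (i : ℕ) • Finsupp.single (σ.face i) (1 : ℤ)

theorem boundary_single {X : Type u} [ClosureSpace X] {n : ℕ} (σ : SingularSimplex X (n + 1)) :
    boundary X n (Finsupp.single σ 1) =
      ∑ i : Fin (n + 2), (-1 : ℤ) ^ (i : ℕ) • Finsupp.single (σ.face i) (1 : ℤ) := by
  simp only [boundary, Finsupp.linearCombination_single, one_smul]

theorem face_face {X : Type u} [ClosureSpace X] {n : ℕ} (σ : SingularSimplex X (n + 2))
    (i : Fin (n + 2)) (j : Fin (n + 3)) (h : (j : ℕ) ≤ (i : ℕ)) :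
    (σ.face j).face i =
      (σ.face i.succ).face (j.castLT (lt_of_le_of_lt h i.isLt)) := by
  ext t : 2
  simp only [SingularSimplex.face, Function.comp_apply, faceMap, stdSimplex.map_comp_apply]
  congr 2
  funext k
  simp only [Function.comp_apply, Fin.succAbove, Fin.lt_def, Fin.ext_iff]
  split_ifs <;> simp_all <;> omega

theorem boundary_boundary (X : Type u) [ClosureSpace X] (n : ℕ) :
    boundary X n ∘ₗ boundary X (n + 1) = 0 := by
  refine Finsupp.lhom_ext' fun σ => LinearMap.ext_ring ?_
  simp only [LinearMap.comp_apply, Finsupp.lsingle_apply, LinearMap.zero_apply, boundary_single,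
    map_sum, map_smul, Finset.smul_sum, smul_smul]
  rw [Finset.sum_comm]
  rw [← Finset.sum_product']
  let P := Fin (n + 2) × Fin (n + 3)
  let S : Finset P := {ij : P | (ij.2 : ℕ) ≤ (ij.1 : ℕ)}
  rw [Finset.univ_product_univ, ← Finset.sum_add_sum_compl S, ← eq_neg_iff_add_eq_zero,
    ← Finset.sum_neg_distrib]
  let φ : ∀ ij : P, ij ∈ S → P := fun ij hij =>
    (Fin.castLT ij.2 (lt_of_le_of_lt (Finset.mem_filter.mp hij).right (Fin.is_lt ij.1)), ij.1.succ)
  apply Finset.sum_bij φ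
  · intro ij hij
    simp_rw [S, φ, Finset.compl_filter, Finset.mem_filter_univ, Fin.val_succ,
      Fin.val_castLT] at hij ⊢
    omega
  · rintro ⟨i, j⟩ hij ⟨i', j'⟩ hij' h
    have h1 := congrArg Fin.val (congrArg Prod.fst h)
    have h2 := congrArg Fin.val (congrArg Prod.snd h)
    simp only [φ, Fin.val_castLT, Fin.val_succ] at h1 h2
    exact Prod.ext (Fin.ext (by simpa using h2)) (Fin.ext h1)
  · rintro ⟨i', j'⟩ hij'
    simp_rw [S, Finset.compl_filter, Finset.mem_filter_univ, not_le] at hij'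
    refine ⟨(j'.pred <| ?_, Fin.castSucc i'), ?_, ?_⟩
    · rintro rfl
      simp only [Fin.val_zero, not_lt_zero] at hij'
    · simpa [S] using Nat.le_sub_one_of_lt hij'
    · simp only [φ, Fin.castLT_castSucc, Fin.succ_pred]
  · rintro ⟨i, j⟩ hij
    simp only [φ]
    rw [face_face σ i j (Finset.mem_filter.mp hij).right, ← neg_smul]
    congr 1
    simp only [Fin.val_succ, Fin.val_castLT, pow_succ]
    ring

/-- The map `f_# : C_n(X) → C_n(Y)` induced by a continuous map `f`. -/
noncomputable def chainMap {X : Type u} {Y : Type v} [ClosureSpace X] [ClosureSpace Y]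
    (f : X → Y) (hf : IsCont f) (n : ℕ) : Chains X n →ₗ[ℤ] Chains Y n :=
  Finsupp.lmapDomain ℤ ℤ fun σ => σ.push f hf

theorem boundary_chainMap {X : Type u} {Y : Type v} [ClosureSpace X] [ClosureSpace Y]
    (f : X → Y) (hf : IsCont f) (n : ℕ) :
    boundary Y n ∘ₗ chainMap f hf (n + 1) = chainMap f hf n ∘ₗ boundary X n := by
  refine Finsupp.lhom_ext' fun σ => LinearMap.ext_ring ?_
  simp only [LinearMap.comp_apply, Finsupp.lsingle_apply, boundary_single, map_sum, map_smul,
    chainMap, Finsupp.lmapDomain_apply, Finsupp.mapDomain_single]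
  rfl

/-- `C_n(A)` as a subgroup of `C_n(X)`: the image of the singular chains of the subspace `A`
under the map induced by the inclusion. -/
noncomputable def subChains {X : Type u} [ClosureSpace X] (A : Set X) (n : ℕ) :
    Submodule ℤ (Chains X n) :=
  LinearMap.range (chainMap (Subtype.val : A → X) (isCont_val A) n)

theorem subChains_le_comap_boundary {X : Type u} [ClosureSpace X] (A : Set X) (n : ℕ) :
    subChains A (n + 1) ≤ (subChains A n).comap (boundary X n) := by
  rintro _ ⟨c, rfl⟩
  exact ⟨boundary A n c, (LinearMap.congr_fun (boundary_chainMap _ (isCont_val A) n) c).symm⟩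

/-- The relative chains `C_n(X, A) = C_n(X) / C_n(A)`. -/
abbrev RelChains {X : Type u} [ClosureSpace X] (A : Set X) (n : ℕ) : Type u :=
  Chains X n ⧸ subChains A n

/-- The boundary map induced on relative chains. -/
noncomputable def relBoundary {X : Type u} [ClosureSpace X] (A : Set X) (n : ℕ) :
    RelChains A (n + 1) →ₗ[ℤ] RelChains A n :=
  Submodule.mapQ _ _ (boundary X n) (subChains_le_comap_boundary A n)

theorem relBoundary_relBoundary {X : Type u} [ClosureSpace X] (A : Set X) (n : ℕ) :
    relBoundary A n ∘ₗ relBoundary A (n + 1) = 0 := by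
  refine Submodule.linearMap_qext _ (LinearMap.ext fun c => ?_)
  have h := LinearMap.congr_fun (boundary_boundary X n) c
  simp only [LinearMap.comp_apply, LinearMap.zero_apply] at h
  simp only [relBoundary, LinearMap.comp_apply, Submodule.mkQ_apply, Submodule.mapQ_apply, h,
    LinearMap.zero_apply, Submodule.Quotient.mk_zero]

/-- The relative singular chain complex of the pair `(X, A)`. -/
noncomputable def relComplex {X : Type u} [ClosureSpace X] (A : Set X) :
    ChainComplex (ModuleCat.{u} ℤ) ℕ :=
  ChainComplex.of (fun n => ModuleCat.of ℤ (RelChains A n))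
    (fun n => ModuleCat.ofHom (relBoundary A n))
    (fun n => by rw [← ModuleCat.ofHom_comp, relBoundary_relBoundary]; rfl)

/-- A continuous map of pairs `f : (X, A) → (Y, B)`. -/
structure PairMap {X : Type u} {Y : Type v} [ClosureSpace X] [ClosureSpace Y]
    (A : Set X) (B : Set Y) where
  toFun : X → Y
  cont : IsCont toFun
  maps : Set.MapsTo toFun A B

theorem isCont_restrict {X : Type u} {Y : Type v} [ClosureSpace X] [ClosureSpace Y]
    {A : Set X} {B : Set Y} (f : PairMap A B) : IsCont f.maps.restrict := by
  rintro C _ ⟨x, hx, rfl⟩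
  have h := f.cont _ ⟨_, hx, rfl⟩
  change f.toFun x ∈ cl (Subtype.val '' (f.maps.restrict '' C))
  refine cl_mono ?_ h
  rintro _ ⟨_, ⟨a, ha, rfl⟩, rfl⟩
  exact ⟨_, ⟨a, ha, rfl⟩, rfl⟩

theorem subChains_le_comap_chainMap {X : Type u} {Y : Type v} [ClosureSpace X] [ClosureSpace Y]
    {A : Set X} {B : Set Y} (f : PairMap A B) (n : ℕ) :
    subChains A n ≤ (subChains B n).comap (chainMap f.toFun f.cont n) := by
  rintro _ ⟨c, rfl⟩
  refine ⟨chainMap f.maps.restrict (isCont_restrict f) n c, ?_⟩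
  simp only [chainMap, Finsupp.lmapDomain_apply, ← Finsupp.mapDomain_comp]
  rfl

/-- The map `C_n(X, A) → C_n(Y, B)` induced by a map of pairs. -/
noncomputable def relChainMap {X : Type u} {Y : Type v} [ClosureSpace X] [ClosureSpace Y]
    {A : Set X} {B : Set Y} (f : PairMap A B) (n : ℕ) : RelChains A n →ₗ[ℤ] RelChains B n :=
  Submodule.mapQ _ _ (chainMap f.toFun f.cont n) (subChains_le_comap_chainMap f n)

theorem relBoundary_relChainMap {X : Type u} {Y : Type v} [ClosureSpace X] [ClosureSpace Y]
    {A : Set X} {B : Set Y} (f : PairMap A B) (n : ℕ) :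
    relBoundary B n ∘ₗ relChainMap f (n + 1) = relChainMap f n ∘ₗ relBoundary A n := by
  refine Submodule.linearMap_qext _ (LinearMap.ext fun c => ?_)
  have h := LinearMap.congr_fun (boundary_chainMap f.toFun f.cont n) c
  simp only [LinearMap.comp_apply] at h
  simp only [relBoundary, relChainMap, LinearMap.comp_apply, Submodule.mkQ_apply,
    Submodule.mapQ_apply, h]

/-- The chain map of relative singular chain complexes induced by a map of pairs. -/
noncomputable def relComplexMap {X Y : Type u} [ClosureSpace X] [ClosureSpace Y]
    {A : Set X} {B : Set Y} (f : PairMap A B) : relComplex A ⟶ relComplex B :=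
  ChainComplex.ofHom (fun n => ModuleCat.ofHom (relChainMap f n)) (fun n => by
    simp only [relComplex, ChainComplex.of_d]
    rw [← ModuleCat.ofHom_comp, ← ModuleCat.ofHom_comp, relBoundary_relChainMap])

/-- The inclusion of the nonnegative degrees into all integer degrees, for chain complexes. -/
def natToInt : (ComplexShape.down ℕ).Embedding (ComplexShape.down ℤ) :=
  ComplexShape.Embedding.mk' _ _ (fun n => (n : ℤ)) Nat.cast_injective
    (fun i j => by simp only [ComplexShape.down_Rel]; omega)

/-- The relative singular homology group `H_n(X, A)`, `n ∈ ℤ`: the homology of the complex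
`C_•(X, A)`, extended by zero to negative degrees. -/
noncomputable def relHomology {X : Type u} [ClosureSpace X] (A : Set X) (n : ℤ) :
    ModuleCat.{u} ℤ :=
  ((relComplex A).extend natToInt).homology n

/-- The map `H_n(X, A) → H_n(Y, B)` induced by a map of pairs. -/
noncomputable def relHomologyMap {X Y : Type u} [ClosureSpace X] [ClosureSpace Y]
    {A : Set X} {B : Set Y} (f : PairMap A B) (n : ℤ) : relHomology A n ⟶ relHomology B n :=
  HomologicalComplex.homologyMap (HomologicalComplex.extendMap (relComplexMap f) natToInt) n

/-- For `T ⊆ A`, the inclusion `(S, T) → (X, A)`, where `S` is a subspace of `X` and `T` is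
regarded as a subset of `S`. -/
def inclusion {X : Type u} [ClosureSpace X] (S : Set X) {T A : Set X} (h : T ⊆ A) :
    PairMap (Subtype.val ⁻¹' T : Set S) A where
  toFun := Subtype.val
  cont := isCont_val S
  maps := fun _ hx => h hx

end ClosureSpace

/-!
Excision is proved by barycentric subdivision. Write `D_n = C_n(A) + C_n(B)` for the small chains,
where every point of `X` lies in `i(A)` or in `i(B)`.

*Subdivision.* On formal combinations of tuples of points of a simplex, the cone from the barycenter
gives by recursion a subdivision operator `S` and a homotopy `T` with `∂T + T∂ = 1 - S`
(`linBoundary_linHomotopy`). Both commute with affine maps, so applying a singular simplex `σ` to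
the subdivided standard simplex defines natural operators on singular chains with the same
identities (`boundary_subdiv`, `boundary_subdivHomotopy_succ`). Being natural, they preserve `C(A)`, `C(B)` and
`D`.

*Smallness.* One subdivision shrinks the simplices of dimension at most `n` by the factor
`n / (n + 1)` (`linSubdiv_mem_smallTuples`). For a singular simplex `σ` in `X` the interiors of
`σ⁻¹(A)` and `σ⁻¹(B)` cover the compact metric space `Δⁿ` (`preimage_int_subset`), so by the
Lebesgue number lemma some iterated subdivision of `σ` is in `D` (`exists_subdiv_pow_mem`). Apart
from the composition of continuous maps, the closure structure of `X` enters only here and in the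
fact that a singular simplex with image in `A` is a singular simplex of the subspace `A`.

*Homology.* The map `C(B)/C(A ∩ B) → C(X)/C(A)` is injective with image `D/C(A)`. It is a
quasi-isomorphism once its cokernel `C(X)/D` is acyclic (`quasiIso_of_injective`), that is, once
every chain `z` with `∂z ∈ D` differs from a chain in `D` by a boundary. This holds because
`z - S^m z` is a boundary modulo `D` and `S^m z ∈ D` for large `m`
(`exists_sub_boundary_mem_smallChains_succ`).
-/

namespace ClosureSpace

theorem map_mem_of_mem_supported {α : Type*} {M : Type*} [AddCommGroup M]
    (F : (α →₀ ℤ) →ₗ[ℤ] M) {s : Set α} {N : Submodule ℤ M}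
    (h : ∀ a ∈ s, F (Finsupp.single a 1) ∈ N) {c : α →₀ ℤ} (hc : c ∈ Finsupp.supported ℤ ℤ s) :
    F c ∈ N := by
  rw [Finsupp.supported_eq_span_single] at hc
  have : Submodule.span ℤ ((fun a => Finsupp.single a (1 : ℤ)) '' s) ≤ N.comap F := by
    rw [Submodule.span_le]
    rintro _ ⟨a, ha, rfl⟩
    exact h a ha
  exact this hc

/-! ### Linear chains and their barycentric subdivision -/

section Linear

variable {V : Type*} {W : Type*}

/-- Linear chains: formal integer combinations of `k`-tuples of points of `V`, thought of as the
vertices of an affine `(k-1)`-simplex. The index is the number of vertices, so `LinChains V 0` is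
the copy of `ℤ` in degree `-1` of the augmented complex. -/
abbrev LinChains (V : Type*) (k : ℕ) : Type _ := (Fin k → V) →₀ ℤ

/-- The boundary of linear chains, the alternating sum of the omissions of one vertex; from
`LinChains V 1` to `LinChains V 0` it is the augmentation. -/
noncomputable def linBoundary (V : Type*) (k : ℕ) : LinChains V (k + 1) →ₗ[ℤ] LinChains V k :=
  Finsupp.linearCombination ℤ fun v : Fin (k + 1) → V =>
    ∑ i : Fin (k + 1), (-1 : ℤ) ^ (i : ℕ) • Finsupp.single (v ∘ i.succAbove) (1 : ℤ)

theorem linBoundary_single {k : ℕ} (v : Fin (k + 1) → V) :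
    linBoundary V k (Finsupp.single v 1) =
      ∑ i : Fin (k + 1), (-1 : ℤ) ^ (i : ℕ) • Finsupp.single (v ∘ i.succAbove) (1 : ℤ) := by
  simp only [linBoundary, Finsupp.linearCombination_single, one_smul]

/-- The cone with apex `b`: put `b` in front of every tuple. -/
noncomputable def cone (b : V) (k : ℕ) : LinChains V k →ₗ[ℤ] LinChains V (k + 1) :=
  Finsupp.lmapDomain ℤ ℤ fun v : Fin k → V => (Fin.cons b v : Fin (k + 1) → V)

theorem cone_single (b : V) {k : ℕ} (v : Fin k → V) :
    cone b k (Finsupp.single v 1) = Finsupp.single (Fin.cons b v : Fin (k + 1) → V) 1 := by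
  simp only [cone, Finsupp.lmapDomain_apply, Finsupp.mapDomain_single]

/-- The map of linear chains that applies `f` to every vertex. -/
noncomputable def mapVertices (f : V → W) (k : ℕ) : LinChains V k →ₗ[ℤ] LinChains W k :=
  Finsupp.lmapDomain ℤ ℤ (f ∘ ·)

theorem mapVertices_single (f : V → W) {k : ℕ} (v : Fin k → V) :
    mapVertices f k (Finsupp.single v 1) = Finsupp.single (f ∘ v) 1 := by
  simp only [mapVertices, Finsupp.lmapDomain_apply, Finsupp.mapDomain_single]

theorem linBoundary_cone_zero (b : V) (c : LinChains V 0) :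
    linBoundary V 0 (cone b 0 c) = c := by
  suffices h : linBoundary V 0 ∘ₗ cone b 0 = LinearMap.id from LinearMap.congr_fun h c
  refine Finsupp.lhom_ext' fun v => LinearMap.ext_ring ?_
  simp only [LinearMap.comp_apply, Finsupp.lsingle_apply, cone_single, linBoundary_single,
    LinearMap.id_apply]
  rw [Fin.sum_univ_succ, Fin.sum_univ_zero, add_zero, Fin.val_zero, pow_zero, one_smul,
    Fin.succAbove_zero]
  rfl

theorem cons_comp_succ_succAbove (b : V) {k : ℕ} (v : Fin (k + 1) → V) (i : Fin (k + 1)) :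
    (Fin.cons b v : Fin (k + 2) → V) ∘ i.succ.succAbove =
      (Fin.cons b (v ∘ i.succAbove) : Fin (k + 1) → V) := by
  funext j
  refine Fin.cases ?_ (fun j => ?_) j
  · simp
  · simp [Fin.succ_succAbove_succ]

/-- The cone is a contracting homotopy of the augmented complex of linear chains. -/
theorem linBoundary_cone_succ (b : V) {k : ℕ} (c : LinChains V (k + 1)) :
    linBoundary V (k + 1) (cone b (k + 1) c) = c - cone b k (linBoundary V k c) := by
  suffices h : linBoundary V (k + 1) ∘ₗ cone b (k + 1) =
      LinearMap.id - cone b k ∘ₗ linBoundary V k from LinearMap.congr_fun h c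
  refine Finsupp.lhom_ext' fun v => LinearMap.ext_ring ?_
  simp only [LinearMap.comp_apply, Finsupp.lsingle_apply, cone_single, linBoundary_single,
    LinearMap.sub_apply, LinearMap.id_apply, map_sum, map_smul]
  rw [Fin.sum_univ_succ, sub_eq_add_neg, ← Finset.sum_neg_distrib]
  congr 1
  · simp only [Fin.val_zero, pow_zero, one_smul, Fin.succAbove_zero]
    rfl
  · refine Finset.sum_congr rfl fun i _ => ?_
    rw [cons_comp_succ_succAbove, Fin.val_succ, pow_succ, mul_neg_one, neg_smul]

/-- Every tuple is the cone of its tail with its first entry as the apex, so `∂∂ = 0` follows from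
the cone formulas by induction, without cancelling pairs of faces. -/
theorem linBoundary_linBoundary (k : ℕ) (c : LinChains V (k + 2)) :
    linBoundary V k (linBoundary V (k + 1) c) = 0 := by
  induction k with
  | zero =>
    suffices h : linBoundary V 0 ∘ₗ linBoundary V 1 = 0 from LinearMap.congr_fun h c
    refine Finsupp.lhom_ext' fun v => LinearMap.ext_ring ?_
    simp only [LinearMap.comp_apply, Finsupp.lsingle_apply, LinearMap.zero_apply]
    rw [← Fin.cons_self_tail v, ← cone_single, linBoundary_cone_succ, map_sub,
      linBoundary_cone_zero, sub_self]
  | succ k ih =>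
    suffices h : linBoundary V (k + 1) ∘ₗ linBoundary V (k + 2) = 0 from LinearMap.congr_fun h c
    refine Finsupp.lhom_ext' fun v => LinearMap.ext_ring ?_
    simp only [LinearMap.comp_apply, Finsupp.lsingle_apply, LinearMap.zero_apply]
    rw [← Fin.cons_self_tail v, ← cone_single, linBoundary_cone_succ, map_sub,
      linBoundary_cone_succ, ih, map_zero, sub_zero, sub_self]

theorem linBoundary_mapVertices (f : V → W) {k : ℕ} (c : LinChains V (k + 1)) :
    linBoundary W k (mapVertices f (k + 1) c) = mapVertices f k (linBoundary V k c) := by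
  suffices h : linBoundary W k ∘ₗ mapVertices f (k + 1) = mapVertices f k ∘ₗ linBoundary V k from
    LinearMap.congr_fun h c
  refine Finsupp.lhom_ext' fun v => LinearMap.ext_ring ?_
  simp only [LinearMap.comp_apply, Finsupp.lsingle_apply, mapVertices_single, linBoundary_single,
    map_sum, map_smul, Function.comp_assoc]

theorem mapVertices_cone (f : V → W) (b : V) {k : ℕ} (c : LinChains V k) :
    mapVertices f (k + 1) (cone b k c) = cone (f b) k (mapVertices f k c) := by
  suffices h : mapVertices f (k + 1) ∘ₗ cone b k = cone (f b) k ∘ₗ mapVertices f k from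
    LinearMap.congr_fun h c
  refine Finsupp.lhom_ext' fun v => LinearMap.ext_ring ?_
  simp only [LinearMap.comp_apply, Finsupp.lsingle_apply, mapVertices_single, cone_single]
  rw [Fin.comp_cons]

/-- Barycentric subdivision of linear chains, with respect to an arbitrary choice `bary` of a point
for every nonempty tuple: subdivide the boundary and take the cone from the chosen point. -/
noncomputable def linSubdiv (bary : ∀ k : ℕ, (Fin (k + 1) → V) → V) :
    ∀ k : ℕ, LinChains V k →ₗ[ℤ] LinChains V k
  | 0 => LinearMap.id
  | k + 1 => Finsupp.linearCombination ℤ fun v : Fin (k + 1) → V =>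
      cone (bary k v) k (linSubdiv bary k (linBoundary V k (Finsupp.single v 1)))

/-- The chain homotopy between the identity and `linSubdiv`: `T v = b (v - T ∂v)`, where `b` is the
cone from the point chosen for `v`. -/
noncomputable def linHomotopy (bary : ∀ k : ℕ, (Fin (k + 1) → V) → V) :
    ∀ k : ℕ, LinChains V k →ₗ[ℤ] LinChains V (k + 1)
  | 0 => 0
  | k + 1 => Finsupp.linearCombination ℤ fun v : Fin (k + 1) → V =>
      cone (bary k v) (k + 1) (Finsupp.single v 1 -
        linHomotopy bary k (linBoundary V k (Finsupp.single v 1)))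

variable {bary : ∀ k : ℕ, (Fin (k + 1) → V) → V} {bary' : ∀ k : ℕ, (Fin (k + 1) → W) → W}

theorem linSubdiv_zero (c : LinChains V 0) : linSubdiv bary 0 c = c := rfl

theorem linHomotopy_zero (c : LinChains V 0) : linHomotopy bary 0 c = 0 := rfl

theorem linSubdiv_succ_single {k : ℕ} (v : Fin (k + 1) → V) :
    linSubdiv bary (k + 1) (Finsupp.single v 1) =
      cone (bary k v) k (linSubdiv bary k (linBoundary V k (Finsupp.single v 1))) := by
  rw [linSubdiv, Finsupp.linearCombination_single, one_smul]

theorem linHomotopy_succ_single {k : ℕ} (v : Fin (k + 1) → V) :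
    linHomotopy bary (k + 1) (Finsupp.single v 1) =
      cone (bary k v) (k + 1) (Finsupp.single v 1 -
        linHomotopy bary k (linBoundary V k (Finsupp.single v 1))) := by
  rw [linHomotopy, Finsupp.linearCombination_single, one_smul]

theorem linBoundary_linSubdiv {k : ℕ} (c : LinChains V (k + 1)) :
    linBoundary V k (linSubdiv bary (k + 1) c) = linSubdiv bary k (linBoundary V k c) := by
  suffices h : linBoundary V k ∘ₗ linSubdiv bary (k + 1) =
      linSubdiv bary k ∘ₗ linBoundary V k from LinearMap.congr_fun h c
  clear c
  induction k with
  | zero =>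
    refine Finsupp.lhom_ext' fun v => LinearMap.ext_ring ?_
    simp only [LinearMap.comp_apply, Finsupp.lsingle_apply, linSubdiv_succ_single,
      linBoundary_cone_zero]
  | succ k ih =>
    refine Finsupp.lhom_ext' fun v => LinearMap.ext_ring ?_
    have h := LinearMap.congr_fun ih (linBoundary V (k + 1) (Finsupp.single v 1))
    simp only [LinearMap.comp_apply, linBoundary_linBoundary, map_zero] at h
    simp only [LinearMap.comp_apply, Finsupp.lsingle_apply]
    rw [linSubdiv_succ_single, linBoundary_cone_succ, h, map_zero, sub_zero]

theorem linBoundary_linHomotopy {k : ℕ} (c : LinChains V (k + 1)) :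
    linBoundary V (k + 1) (linHomotopy bary (k + 1) c) =
      c - linSubdiv bary (k + 1) c - linHomotopy bary k (linBoundary V k c) := by
  suffices h : linBoundary V (k + 1) ∘ₗ linHomotopy bary (k + 1) =
      LinearMap.id - linSubdiv bary (k + 1) - linHomotopy bary k ∘ₗ linBoundary V k from
    LinearMap.congr_fun h c
  clear c
  induction k with
  | zero =>
    refine Finsupp.lhom_ext' fun v => LinearMap.ext_ring ?_
    simp only [LinearMap.comp_apply, LinearMap.sub_apply, LinearMap.id_apply,
      Finsupp.lsingle_apply, linHomotopy_succ_single, linSubdiv_succ_single, linHomotopy_zero,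
      linSubdiv_zero, linBoundary_cone_succ, sub_zero]
  | succ k ih =>
    refine Finsupp.lhom_ext' fun v => LinearMap.ext_ring ?_
    have h := LinearMap.congr_fun ih (linBoundary V (k + 1) (Finsupp.single v 1))
    simp only [LinearMap.comp_apply, LinearMap.sub_apply, LinearMap.id_apply,
      linBoundary_linBoundary, map_zero, sub_zero] at h
    simp only [LinearMap.comp_apply, LinearMap.sub_apply, LinearMap.id_apply,
      Finsupp.lsingle_apply]
    rw [linHomotopy_succ_single, linSubdiv_succ_single, linBoundary_cone_succ,
      map_sub (linBoundary V (k + 1)), h, sub_sub_cancel]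
    abel

theorem mapVertices_linSubdiv {f : V → W} (hf : ∀ k v, f (bary k v) = bary' k (f ∘ v)) {k : ℕ}
    (c : LinChains V k) :
    mapVertices f k (linSubdiv bary k c) = linSubdiv bary' k (mapVertices f k c) := by
  induction k with
  | zero => rfl
  | succ k ih =>
    suffices h : mapVertices f (k + 1) ∘ₗ linSubdiv bary (k + 1) =
        linSubdiv bary' (k + 1) ∘ₗ mapVertices f (k + 1) from LinearMap.congr_fun h c
    refine Finsupp.lhom_ext' fun v => LinearMap.ext_ring ?_
    simp only [LinearMap.comp_apply, Finsupp.lsingle_apply]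
    rw [linSubdiv_succ_single, mapVertices_cone, ih, ← linBoundary_mapVertices,
      mapVertices_single, linSubdiv_succ_single, hf]

theorem mapVertices_linHomotopy {f : V → W} (hf : ∀ k v, f (bary k v) = bary' k (f ∘ v)) {k : ℕ}
    (c : LinChains V k) :
    mapVertices f (k + 1) (linHomotopy bary k c) = linHomotopy bary' k (mapVertices f k c) := by
  induction k with
  | zero => simp only [linHomotopy_zero, map_zero]
  | succ k ih =>
    suffices h : mapVertices f (k + 2) ∘ₗ linHomotopy bary (k + 1) =
        linHomotopy bary' (k + 1) ∘ₗ mapVertices f (k + 1) from LinearMap.congr_fun h c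
    refine Finsupp.lhom_ext' fun v => LinearMap.ext_ring ?_
    simp only [LinearMap.comp_apply, Finsupp.lsingle_apply]
    rw [linHomotopy_succ_single, mapVertices_cone, map_sub, ih, ← linBoundary_mapVertices,
      mapVertices_single, linHomotopy_succ_single, hf]

theorem linBoundary_mem_supported {k : ℕ} {s : Set (Fin (k + 1) → V)} {t : Set (Fin k → V)}
    (h : ∀ v ∈ s, ∀ i : Fin (k + 1), v ∘ i.succAbove ∈ t) {c : LinChains V (k + 1)}
    (hc : c ∈ Finsupp.supported ℤ ℤ s) : linBoundary V k c ∈ Finsupp.supported ℤ ℤ t := by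
  refine map_mem_of_mem_supported _ (fun v hv => ?_) hc
  rw [linBoundary_single]
  exact Submodule.sum_mem _ fun i _ =>
    Submodule.smul_mem _ _ (Finsupp.single_mem_supported ℤ 1 (h v hv i))

theorem cone_mem_supported {b : V} {k : ℕ} {s : Set (Fin k → V)} {t : Set (Fin (k + 1) → V)}
    (h : ∀ v ∈ s, (Fin.cons b v : Fin (k + 1) → V) ∈ t) {c : LinChains V k}
    (hc : c ∈ Finsupp.supported ℤ ℤ s) : cone b k c ∈ Finsupp.supported ℤ ℤ t := by
  refine map_mem_of_mem_supported _ (fun v hv => ?_) hc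
  rw [cone_single]
  exact Finsupp.single_mem_supported ℤ 1 (h v hv)

/-- Subdivision creates no vertices outside a set that is closed under the choice of points; with
barycenters, this applies to convex sets. -/
theorem linSubdiv_mem_supported {K : Set V} (hK : ∀ k v, (∀ i, v i ∈ K) → bary k v ∈ K) {k : ℕ}
    {c : LinChains V k} (hc : c ∈ Finsupp.supported ℤ ℤ {v | ∀ i, v i ∈ K}) :
    linSubdiv bary k c ∈ Finsupp.supported ℤ ℤ {v | ∀ i, v i ∈ K} := by
  induction k with
  | zero => exact hc
  | succ k ih =>
    refine map_mem_of_mem_supported _ (fun v hv => ?_) hc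
    rw [linSubdiv_succ_single]
    refine cone_mem_supported (fun w hw => ?_) (ih (linBoundary_mem_supported
      (s := {v | ∀ i, v i ∈ K})
      (t := {v | ∀ i, v i ∈ K}) (fun w hw i j => hw (i.succAbove j))
      (Finsupp.single_mem_supported ℤ 1 hv)))
    exact Fin.cases (hK k v hv) hw

end Linear

/-! ### Affine simplices and the mesh of the subdivision -/

/-- The affine map of standard simplices that sends the `i`-th vertex to `v i`. -/
noncomputable def affineMap {m n : ℕ} (v : Fin (m + 1) → stdSimplex ℝ (Fin (n + 1)))
    (t : stdSimplex ℝ (Fin (m + 1))) : stdSimplex ℝ (Fin (n + 1)) :=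
  ⟨∑ i, t i • (v i : Fin (n + 1) → ℝ),
    (convex_stdSimplex ℝ _).sum_mem (fun i _ => t.2.1 i) t.2.2 fun i _ => (v i).2⟩

theorem coe_affineMap {m n : ℕ} (v : Fin (m + 1) → stdSimplex ℝ (Fin (n + 1)))
    (t : stdSimplex ℝ (Fin (m + 1))) :
    (affineMap v t : Fin (n + 1) → ℝ) = ∑ i, t i • (v i : Fin (n + 1) → ℝ) := rfl

theorem continuous_affineMap {m n : ℕ} (v : Fin (m + 1) → stdSimplex ℝ (Fin (n + 1))) :
    Continuous (affineMap v) := by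
  refine Continuous.subtype_mk (continuous_finsetSum _ fun i _ => ?_) _
  exact ((continuous_apply i).comp continuous_subtype_val).smul continuous_const

theorem isCont_affineMap {m n : ℕ} (v : Fin (m + 1) → stdSimplex ℝ (Fin (n + 1))) :
    IsCont (affineMap v) := fun _ =>
  image_closure_subset_closure_image (continuous_affineMap v)

theorem affineMap_affineMap {l m n : ℕ} (u : Fin (m + 1) → stdSimplex ℝ (Fin (n + 1)))
    (v : Fin (l + 1) → stdSimplex ℝ (Fin (m + 1))) (t : stdSimplex ℝ (Fin (l + 1))) :
    affineMap u (affineMap v t) = affineMap (affineMap u ∘ v) t := by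
  apply stdSimplex.ext
  have h : ∀ j, affineMap v t j = ∑ i, t i * v i j := fun j => by
    rw [coe_affineMap, Finset.sum_apply]
    rfl
  simp only [coe_affineMap, h, Function.comp_apply, Finset.sum_smul, Finset.smul_sum, mul_smul]
  exact Finset.sum_comm

theorem affineMap_faceMap {m n : ℕ} (v : Fin (m + 2) → stdSimplex ℝ (Fin (n + 1)))
    (i : Fin (m + 2)) (t : stdSimplex ℝ (Fin (m + 1))) :
    affineMap v (faceMap i t) = affineMap (v ∘ i.succAbove) t := by
  classical
  apply stdSimplex.ext
  rw [coe_affineMap, coe_affineMap, Fin.sum_univ_succAbove _ i]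
  have h0 : faceMap i t i = 0 := by
    rw [faceMap, stdSimplex.map_coe, FunOnFinite.linearMap_apply_apply]
    exact Finset.sum_eq_zero fun j hj =>
      absurd (Finset.mem_filter.1 hj).2 (Fin.succAbove_ne i j)
  have h1 : ∀ j, faceMap i t (i.succAbove j) = t j := fun j => by
    rw [faceMap, stdSimplex.map_coe, FunOnFinite.linearMap_apply_apply]
    rw [Finset.sum_eq_single j]
    · intro k hk hkj
      exact absurd (Fin.succAbove_right_injective (Finset.mem_filter.1 hk).2) hkj
    · intro h
      exact (h (Finset.mem_filter.2 ⟨Finset.mem_univ j, rfl⟩)).elim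
  simp only [h0, h1, zero_smul, zero_add, Function.comp_apply]

/-- The tuple of the vertices of the standard simplex. -/
noncomputable def vertices (n : ℕ) : Fin (n + 1) → stdSimplex ℝ (Fin (n + 1)) :=
  fun i => stdSimplex.vertex i

theorem affineMap_vertices {n : ℕ} (t : stdSimplex ℝ (Fin (n + 1))) :
    affineMap (vertices n) t = t := by
  apply stdSimplex.ext
  funext j
  rw [coe_affineMap, Finset.sum_apply, Finset.sum_eq_single j]
  · simp only [vertices, stdSimplex.vertex_coe, Pi.smul_apply, Pi.single_eq_same,
      smul_eq_mul, mul_one]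
  · intro i _ hij
    simp only [vertices, stdSimplex.vertex_coe, Pi.smul_apply, Pi.single_eq_of_ne' hij, smul_zero]
  · intro h
    exact absurd (Finset.mem_univ j) h

theorem affineMap_vertex {m n : ℕ} (v : Fin (m + 1) → stdSimplex ℝ (Fin (n + 1)))
    (i : Fin (m + 1)) : affineMap v (vertices m i) = v i := by
  apply stdSimplex.ext
  rw [coe_affineMap, Finset.sum_eq_single i]
  · change (Pi.single i 1 : Fin (m + 1) → ℝ) i • _ = _
    rw [Pi.single_eq_same, one_smul]
  · intro j _ hji
    change (Pi.single i 1 : Fin (m + 1) → ℝ) j • _ = _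
    rw [Pi.single_eq_of_ne hji, zero_smul]
  · intro h
    exact absurd (Finset.mem_univ i) h

/-- The barycenter of a tuple of points of a standard simplex. -/
noncomputable def bary (n k : ℕ) (v : Fin (k + 1) → stdSimplex ℝ (Fin (n + 1))) :
    stdSimplex ℝ (Fin (n + 1)) :=
  affineMap v stdSimplex.barycenter

theorem affineMap_bary {m n : ℕ} (u : Fin (m + 1) → stdSimplex ℝ (Fin (n + 1))) (k : ℕ)
    (v : Fin (k + 1) → stdSimplex ℝ (Fin (m + 1))) :
    affineMap u (bary m k v) = bary n k (affineMap u ∘ v) :=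
  affineMap_affineMap u v _

/-- Balls are convex, so an affine simplex stays in every closed ball that contains its vertices. -/
theorem affineMap_mem_closedBall {m n : ℕ} {v : Fin (m + 1) → stdSimplex ℝ (Fin (n + 1))}
    {p : stdSimplex ℝ (Fin (n + 1))} {r : ℝ} (h : ∀ i, dist (v i) p ≤ r)
    (t : stdSimplex ℝ (Fin (m + 1))) : dist (affineMap v t) p ≤ r :=
  (convex_closedBall (p : Fin (n + 1) → ℝ) r).sum_mem (fun i _ => t.2.1 i) t.2.2 fun i _ => h i

/-- The barycenter `b` of `k + 1` points satisfies `v j - b = ∑ i, (v j - v i) / (k + 1)`, where the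
term `i = j` vanishes; hence the factor `k / (k + 1)`. -/
theorem dist_bary_le {n k : ℕ} {v : Fin (k + 1) → stdSimplex ℝ (Fin (n + 1))} {δ : ℝ}
    (h : ∀ i j, dist (v i) (v j) ≤ δ) (j : Fin (k + 1)) :
    dist (v j) (bary n k v) ≤ k / (k + 1) * δ := by
  have hb : ((v j : Fin (n + 1) → ℝ) - (bary n k v : Fin (n + 1) → ℝ)) =
      ∑ i, ((k : ℝ) + 1)⁻¹ • ((v j : Fin (n + 1) → ℝ) - (v i : Fin (n + 1) → ℝ)) := by
    have : ∀ i : Fin (k + 1),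
        (stdSimplex.barycenter : stdSimplex ℝ (Fin (k + 1))) i = ((k : ℝ) + 1)⁻¹ := fun i => by
      change ((Fintype.card (Fin (k + 1)) : ℝ))⁻¹ = _
      rw [Fintype.card_fin, Nat.cast_succ]
    simp only [bary, coe_affineMap, this, smul_sub, Finset.sum_sub_distrib, Finset.sum_const,
      Finset.card_univ, Fintype.card_fin, ← Nat.cast_smul_eq_nsmul ℝ, smul_smul, Nat.cast_succ]
    rw [mul_inv_cancel₀ (by positivity), one_smul]
  change dist (v j : Fin (n + 1) → ℝ) (bary n k v : Fin (n + 1) → ℝ) ≤ _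
  rw [dist_eq_norm, hb, Fin.sum_univ_succAbove _ j, sub_self, smul_zero, zero_add]
  refine (norm_sum_le_of_le (f := fun i => ((k : ℝ) + 1)⁻¹ •
    ((v j : Fin (n + 1) → ℝ) - (v (j.succAbove i) : Fin (n + 1) → ℝ)))
    (n := fun _ => ((k : ℝ) + 1)⁻¹ * δ) _ fun i _ => ?_).trans_eq ?_
  · rw [norm_smul, Real.norm_of_nonneg (by positivity), ← dist_eq_norm]
    exact mul_le_mul_of_nonneg_left (h j _) (by positivity)
  · rw [Finset.sum_const, Finset.card_univ, Fintype.card_fin, nsmul_eq_mul]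
    ring

/-- The tuples whose pairwise distances are at most `δ`, that is, the vertex tuples of the affine
simplices of diameter at most `δ`. -/
def smallTuples (n k : ℕ) (δ : ℝ) : Set (Fin k → stdSimplex ℝ (Fin (n + 1))) :=
  {v | ∀ i j, dist (v i) (v j) ≤ δ}

/-- Subdivision shrinks the mesh: the pairwise distances of at most `k` vertices shrink by any
factor `r` that is at least `(k - 1) / k`. -/
theorem linSubdiv_mem_smallTuples {n k : ℕ} {r δ : ℝ} (hδ : 0 ≤ δ) (hr0 : 0 ≤ r)
    (hr : ∀ j : ℕ, j < k → (j / (j + 1) : ℝ) ≤ r)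
    {c : LinChains (stdSimplex ℝ (Fin (n + 1))) k}
    (hc : c ∈ Finsupp.supported ℤ ℤ (smallTuples n k δ)) :
    linSubdiv (bary n) k c ∈ Finsupp.supported ℤ ℤ (smallTuples n k (r * δ)) := by
  induction k with
  | zero => exact fun v _ i => i.elim0
  | succ k ih =>
    refine map_mem_of_mem_supported _ (fun v hv => ?_) hc
    rw [linSubdiv_succ_single]
    have hv1 : Finsupp.single v (1 : ℤ) ∈ Finsupp.supported ℤ ℤ {v} :=
      Finsupp.single_mem_supported ℤ 1 rfl
    -- Every vertex of the subdivided boundary lies in the ball `K` around the barycenter, which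
    -- bounds the distances from the apex; the other distances are bounded by induction.
    let K : Set (stdSimplex ℝ (Fin (n + 1))) := {x | dist x (bary n k v) ≤ r * δ}
    have hK : ∀ l (w : Fin (l + 1) → stdSimplex ℝ (Fin (n + 1))), (∀ i, w i ∈ K) →
        bary n l w ∈ K := fun l w hw => affineMap_mem_closedBall hw _
    have hvK : ∀ j, v j ∈ K := fun j =>
      (dist_bary_le hv j).trans (mul_le_mul_of_nonneg_right (hr k k.lt_succ_self) hδ)
    have h1 : linSubdiv (bary n) k (linBoundary _ k (Finsupp.single v 1)) ∈
        Finsupp.supported ℤ ℤ (smallTuples n k (r * δ)) := by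
      refine ih (fun j hj => hr j (hj.trans k.lt_succ_self)) (linBoundary_mem_supported ?_ hv1)
      rintro _ rfl i j l
      exact hv _ _
    have h2 : linSubdiv (bary n) k (linBoundary _ k (Finsupp.single v 1)) ∈
        Finsupp.supported ℤ ℤ {w | ∀ i, w i ∈ K} := by
      refine linSubdiv_mem_supported hK (linBoundary_mem_supported ?_ hv1)
      rintro _ rfl i j
      exact hvK _
    refine cone_mem_supported (s := smallTuples n k (r * δ) ∩ {w | ∀ i, w i ∈ K}) ?_
      (Set.subset_inter h1 h2)
    rintro w ⟨hw, hwK⟩ i j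
    refine Fin.cases (Fin.cases ?_ (fun j => ?_) j) (fun i => Fin.cases ?_ (fun j => ?_) j) i
    · rw [dist_self]
      positivity
    · rw [dist_comm]
      exact hwK j
    · exact hwK i
    · exact hw i j

theorem exists_linSubdiv_pow_mem_smallTuples (n : ℕ) {δ : ℝ} (hδ : 0 < δ) :
    ∃ m : ℕ, ((linSubdiv (bary n) (n + 1)) ^ m) (Finsupp.single (vertices n) 1) ∈
      Finsupp.supported ℤ ℤ (smallTuples n (n + 1) δ) := by
  let r : ℝ := n / (n + 1)
  have hr0 : 0 ≤ r := by positivity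
  have hr1 : r < 1 := (div_lt_one (by positivity)).2 (lt_add_one _)
  have hr : ∀ j : ℕ, j < n + 1 → (j / (j + 1) : ℝ) ≤ r := fun j hj => by
    have : (j : ℝ) ≤ n := by exact_mod_cast Nat.lt_succ_iff.1 hj
    rw [div_le_div_iff₀ (by positivity) (by positivity)]
    nlinarith
  let D : ℝ := Metric.diam (Set.univ : Set (stdSimplex ℝ (Fin (n + 1))))
  have hD0 : 0 ≤ D := Metric.diam_nonneg
  have hpow : ∀ m : ℕ, ((linSubdiv (bary n) (n + 1)) ^ m) (Finsupp.single (vertices n) 1) ∈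
      Finsupp.supported ℤ ℤ (smallTuples n (n + 1) (r ^ m * D)) := fun m => by
    induction m with
    | zero =>
      rw [pow_zero, pow_zero, one_mul]
      exact Finsupp.single_mem_supported ℤ 1 fun i j =>
        Metric.dist_le_diam_of_mem isCompact_univ.isBounded (Set.mem_univ _) (Set.mem_univ _)
    | succ m ih =>
      rw [pow_succ', pow_succ', mul_assoc]
      exact linSubdiv_mem_smallTuples (by positivity) hr0 hr ih
  obtain ⟨m, hm⟩ := exists_pow_lt_of_lt_one (show 0 < δ / (D + 1) by positivity) hr1
  refine ⟨m, Finsupp.supported_mono (fun v hv i j => (hv i j).trans ?_) (hpow m)⟩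
  calc r ^ m * D ≤ r ^ m * (D + 1) := by gcongr; linarith
    _ ≤ δ := ((lt_div_iff₀ (by positivity)).1 hm).le

/-! ### Barycentric subdivision of singular chains -/

section Singular

variable {X : Type u} [ClosureSpace X]

/-- The restriction `σ|[v_0, …, v_k]` of a singular simplex to the affine simplex with
vertices `v`. -/
noncomputable def SingularSimplex.restrict {n : ℕ} (σ : SingularSimplex X n) {k : ℕ}
    (v : Fin (k + 1) → stdSimplex ℝ (Fin (n + 1))) : SingularSimplex X k where
  toFun := σ.toFun ∘ affineMap v
  cont := σ.cont.comp (isCont_affineMap v)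

theorem SingularSimplex.restrict_vertices {n : ℕ} (σ : SingularSimplex X n) :
    σ.restrict (vertices n) = σ := by
  ext t
  exact congrArg σ.toFun (affineMap_vertices t)

theorem SingularSimplex.restrict_restrict {n m k : ℕ} (σ : SingularSimplex X n)
    (u : Fin (m + 1) → stdSimplex ℝ (Fin (n + 1))) (v : Fin (k + 1) → stdSimplex ℝ (Fin (m + 1))) :
    (σ.restrict u).restrict v = σ.restrict (affineMap u ∘ v) := by
  ext t
  exact congrArg σ.toFun (affineMap_affineMap u v t)

theorem SingularSimplex.restrict_face {n k : ℕ} (σ : SingularSimplex X n)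
    (v : Fin (k + 2) → stdSimplex ℝ (Fin (n + 1))) (i : Fin (k + 2)) :
    (σ.restrict v).face i = σ.restrict (v ∘ i.succAbove) := by
  ext t
  exact congrArg σ.toFun (affineMap_faceMap v i t)

/-- The map from linear chains of the standard `n`-simplex to singular chains of `X` that is given
by restricting `σ`; tuples with `k + 1` entries give singular `k`-simplices. -/
noncomputable def realize {n : ℕ} (σ : SingularSimplex X n) (k : ℕ) :
    LinChains (stdSimplex ℝ (Fin (n + 1))) (k + 1) →ₗ[ℤ] Chains X k :=
  Finsupp.lmapDomain ℤ ℤ σ.restrict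

theorem realize_single {n k : ℕ} (σ : SingularSimplex X n)
    (v : Fin (k + 1) → stdSimplex ℝ (Fin (n + 1))) :
    realize σ k (Finsupp.single v 1) = Finsupp.single (σ.restrict v) 1 := by
  simp only [realize, Finsupp.lmapDomain_apply, Finsupp.mapDomain_single]

theorem boundary_realize {n k : ℕ} (σ : SingularSimplex X n)
    (c : LinChains (stdSimplex ℝ (Fin (n + 1))) (k + 2)) :
    boundary X k (realize σ (k + 1) c) = realize σ k (linBoundary _ (k + 1) c) := by
  suffices h : boundary X k ∘ₗ realize σ (k + 1) = realize σ k ∘ₗ linBoundary _ (k + 1) from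
    LinearMap.congr_fun h c
  refine Finsupp.lhom_ext' fun v => LinearMap.ext_ring ?_
  simp only [LinearMap.comp_apply, Finsupp.lsingle_apply, realize_single, boundary_single,
    linBoundary_single, map_sum, map_smul, SingularSimplex.restrict_face]

theorem realize_restrict {n m k : ℕ} (σ : SingularSimplex X n)
    (u : Fin (m + 1) → stdSimplex ℝ (Fin (n + 1)))
    (c : LinChains (stdSimplex ℝ (Fin (m + 1))) (k + 1)) :
    realize (σ.restrict u) k c = realize σ k (mapVertices (affineMap u) (k + 1) c) := by
  suffices h : realize (σ.restrict u) k = realize σ k ∘ₗ mapVertices (affineMap u) (k + 1) from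
    LinearMap.congr_fun h c
  refine Finsupp.lhom_ext' fun v => LinearMap.ext_ring ?_
  simp only [LinearMap.comp_apply, Finsupp.lsingle_apply, realize_single, mapVertices_single,
    SingularSimplex.restrict_restrict]

/-- Barycentric subdivision of singular chains: the image under `σ` of the subdivision of the
standard simplex. -/
noncomputable def subdiv (X : Type u) [ClosureSpace X] (n : ℕ) : Chains X n →ₗ[ℤ] Chains X n :=
  Finsupp.linearCombination ℤ fun σ : SingularSimplex X n =>
    realize σ n (linSubdiv (bary n) (n + 1) (Finsupp.single (vertices n) 1))

/-- The chain homotopy between the identity and `subdiv`. -/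
noncomputable def subdivHomotopy (X : Type u) [ClosureSpace X] (n : ℕ) :
    Chains X n →ₗ[ℤ] Chains X (n + 1) :=
  Finsupp.linearCombination ℤ fun σ : SingularSimplex X n =>
    realize σ (n + 1) (linHomotopy (bary n) (n + 1) (Finsupp.single (vertices n) 1))

theorem subdiv_single {n : ℕ} (σ : SingularSimplex X n) :
    subdiv X n (Finsupp.single σ 1) =
      realize σ n (linSubdiv (bary n) (n + 1) (Finsupp.single (vertices n) 1)) := by
  simp only [subdiv, Finsupp.linearCombination_single, one_smul]

theorem subdivHomotopy_single {n : ℕ} (σ : SingularSimplex X n) :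
    subdivHomotopy X n (Finsupp.single σ 1) =
      realize σ (n + 1) (linHomotopy (bary n) (n + 1) (Finsupp.single (vertices n) 1)) := by
  simp only [subdivHomotopy, Finsupp.linearCombination_single, one_smul]

theorem affineMap_comp_vertices {n k : ℕ} (v : Fin (k + 1) → stdSimplex ℝ (Fin (n + 1))) :
    affineMap v ∘ vertices k = v :=
  funext (affineMap_vertex v)

/-- Affine maps preserve barycenters, so the subdivision of singular chains agrees with the
subdivision of linear chains. -/
theorem subdiv_realize {n k : ℕ} (σ : SingularSimplex X n)
    (c : LinChains (stdSimplex ℝ (Fin (n + 1))) (k + 1)) :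
    subdiv X k (realize σ k c) = realize σ k (linSubdiv (bary n) (k + 1) c) := by
  suffices h : subdiv X k ∘ₗ realize σ k = realize σ k ∘ₗ linSubdiv (bary n) (k + 1) from
    LinearMap.congr_fun h c
  refine Finsupp.lhom_ext' fun v => LinearMap.ext_ring ?_
  simp only [LinearMap.comp_apply, Finsupp.lsingle_apply]
  rw [realize_single, subdiv_single, realize_restrict,
    mapVertices_linSubdiv (affineMap_bary v), mapVertices_single, affineMap_comp_vertices]

theorem subdivHomotopy_realize {n k : ℕ} (σ : SingularSimplex X n)
    (c : LinChains (stdSimplex ℝ (Fin (n + 1))) (k + 1)) :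
    subdivHomotopy X k (realize σ k c) = realize σ (k + 1) (linHomotopy (bary n) (k + 1) c) := by
  suffices h : subdivHomotopy X k ∘ₗ realize σ k =
      realize σ (k + 1) ∘ₗ linHomotopy (bary n) (k + 1) from LinearMap.congr_fun h c
  refine Finsupp.lhom_ext' fun v => LinearMap.ext_ring ?_
  simp only [LinearMap.comp_apply, Finsupp.lsingle_apply]
  rw [realize_single, subdivHomotopy_single, realize_restrict,
    mapVertices_linHomotopy (affineMap_bary v), mapVertices_single, affineMap_comp_vertices]

theorem realize_vertices {n : ℕ} (σ : SingularSimplex X n) :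
    realize σ n (Finsupp.single (vertices n) 1) = Finsupp.single σ 1 := by
  rw [realize_single, SingularSimplex.restrict_vertices]

theorem boundary_subdiv {n : ℕ} (c : Chains X (n + 1)) :
    boundary X n (subdiv X (n + 1) c) = subdiv X n (boundary X n c) := by
  suffices h : boundary X n ∘ₗ subdiv X (n + 1) = subdiv X n ∘ₗ boundary X n from
    LinearMap.congr_fun h c
  refine Finsupp.lhom_ext' fun σ => LinearMap.ext_ring ?_
  simp only [LinearMap.comp_apply, Finsupp.lsingle_apply]
  rw [← realize_vertices, subdiv_realize, boundary_realize, boundary_realize, subdiv_realize,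
    linBoundary_linSubdiv]

theorem boundary_subdivHomotopy_zero (c : Chains X 0) :
    boundary X 0 (subdivHomotopy X 0 c) = c - subdiv X 0 c := by
  suffices h : boundary X 0 ∘ₗ subdivHomotopy X 0 = LinearMap.id - subdiv X 0 from
    LinearMap.congr_fun h c
  refine Finsupp.lhom_ext' fun σ => LinearMap.ext_ring ?_
  simp only [LinearMap.comp_apply, LinearMap.sub_apply, LinearMap.id_apply, Finsupp.lsingle_apply]
  rw [← realize_vertices, subdivHomotopy_realize, subdiv_realize, boundary_realize,
    linBoundary_linHomotopy, linHomotopy_zero, sub_zero, map_sub]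

theorem boundary_subdivHomotopy_succ {n : ℕ} (c : Chains X (n + 1)) :
    boundary X (n + 1) (subdivHomotopy X (n + 1) c) =
      c - subdiv X (n + 1) c - subdivHomotopy X n (boundary X n c) := by
  suffices h : boundary X (n + 1) ∘ₗ subdivHomotopy X (n + 1) =
      LinearMap.id - subdiv X (n + 1) - subdivHomotopy X n ∘ₗ boundary X n from
    LinearMap.congr_fun h c
  refine Finsupp.lhom_ext' fun σ => LinearMap.ext_ring ?_
  simp only [LinearMap.comp_apply, LinearMap.sub_apply, LinearMap.id_apply, Finsupp.lsingle_apply]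
  rw [← realize_vertices, subdivHomotopy_realize, subdiv_realize, boundary_realize,
    boundary_realize, subdivHomotopy_realize, linBoundary_linHomotopy, map_sub, map_sub]

variable {Y : Type v} [ClosureSpace Y]

theorem chainMap_single (f : X → Y) (hf : IsCont f) {n : ℕ} (σ : SingularSimplex X n) :
    chainMap f hf n (Finsupp.single σ 1) = Finsupp.single (σ.push f hf) 1 := by
  simp only [chainMap, Finsupp.lmapDomain_apply, Finsupp.mapDomain_single]

theorem chainMap_realize (f : X → Y) (hf : IsCont f) {n k : ℕ} (σ : SingularSimplex X n)
    (c : LinChains (stdSimplex ℝ (Fin (n + 1))) (k + 1)) :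
    chainMap f hf k (realize σ k c) = realize (σ.push f hf) k c := by
  suffices h : chainMap f hf k ∘ₗ realize σ k = realize (σ.push f hf) k from
    LinearMap.congr_fun h c
  refine Finsupp.lhom_ext' fun v => LinearMap.ext_ring ?_
  simp only [LinearMap.comp_apply, Finsupp.lsingle_apply]
  rw [realize_single, realize_single, chainMap_single]
  rfl

theorem chainMap_subdiv (f : X → Y) (hf : IsCont f) {n : ℕ} (c : Chains X n) :
    chainMap f hf n (subdiv X n c) = subdiv Y n (chainMap f hf n c) := by
  suffices h : chainMap f hf n ∘ₗ subdiv X n = subdiv Y n ∘ₗ chainMap f hf n from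
    LinearMap.congr_fun h c
  refine Finsupp.lhom_ext' fun σ => LinearMap.ext_ring ?_
  simp only [LinearMap.comp_apply, Finsupp.lsingle_apply]
  rw [subdiv_single, chainMap_realize, chainMap_single, subdiv_single]

theorem chainMap_subdivHomotopy (f : X → Y) (hf : IsCont f) {n : ℕ} (c : Chains X n) :
    chainMap f hf (n + 1) (subdivHomotopy X n c) = subdivHomotopy Y n (chainMap f hf n c) := by
  suffices h : chainMap f hf (n + 1) ∘ₗ subdivHomotopy X n =
      subdivHomotopy Y n ∘ₗ chainMap f hf n from LinearMap.congr_fun h c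
  refine Finsupp.lhom_ext' fun σ => LinearMap.ext_ring ?_
  simp only [LinearMap.comp_apply, Finsupp.lsingle_apply]
  rw [subdivHomotopy_single, chainMap_realize, chainMap_single, subdivHomotopy_single]

/-! ### Small chains -/

/-- The small chains: the subgroup `C_n(A) + C_n(B)` of `C_n(X)`. -/
noncomputable def smallChains (A B : Set X) (n : ℕ) : Submodule ℤ (Chains X n) :=
  subChains A n ⊔ subChains B n

theorem subdiv_mem_subChains {A : Set X} {n : ℕ} {c : Chains X n} (hc : c ∈ subChains A n) :
    subdiv X n c ∈ subChains A n := by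
  obtain ⟨a, rfl⟩ := hc
  exact ⟨subdiv A n a, chainMap_subdiv _ _ a⟩

theorem subdivHomotopy_mem_subChains {A : Set X} {n : ℕ} {c : Chains X n}
    (hc : c ∈ subChains A n) : subdivHomotopy X n c ∈ subChains A (n + 1) := by
  obtain ⟨a, rfl⟩ := hc
  exact ⟨subdivHomotopy A n a, chainMap_subdivHomotopy _ _ a⟩

theorem subdiv_mem_smallChains {A B : Set X} {n : ℕ} {c : Chains X n}
    (hc : c ∈ smallChains A B n) : subdiv X n c ∈ smallChains A B n := by
  obtain ⟨a, ha, b, hb, rfl⟩ := Submodule.mem_sup.1 hc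
  rw [map_add]
  exact Submodule.add_mem_sup (subdiv_mem_subChains ha) (subdiv_mem_subChains hb)

theorem subdivHomotopy_mem_smallChains {A B : Set X} {n : ℕ} {c : Chains X n}
    (hc : c ∈ smallChains A B n) : subdivHomotopy X n c ∈ smallChains A B (n + 1) := by
  obtain ⟨a, ha, b, hb, rfl⟩ := Submodule.mem_sup.1 hc
  rw [map_add]
  exact Submodule.add_mem_sup (subdivHomotopy_mem_subChains ha) (subdivHomotopy_mem_subChains hb)

theorem subdiv_pow_mem_smallChains {A B : Set X} {n : ℕ} {c : Chains X n}
    (hc : c ∈ smallChains A B n) (m : ℕ) : (subdiv X n ^ m) c ∈ smallChains A B n := by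
  induction m with
  | zero => exact hc
  | succ m ih =>
    rw [pow_succ']
    exact subdiv_mem_smallChains ih

/-- A singular simplex with image in `A` is continuous as a map to the subspace `A`. -/
theorem single_mem_subChains {A : Set X} {n : ℕ} {σ : SingularSimplex X n}
    (h : ∀ t, σ.toFun t ∈ A) : Finsupp.single σ 1 ∈ subChains A n := by
  refine ⟨Finsupp.single ⟨fun t => ⟨σ.toFun t, h t⟩, ?_⟩ 1, ?_⟩
  · rintro C _ ⟨t, ht, rfl⟩
    change σ.toFun t ∈ cl (Subtype.val '' ((fun t => (⟨σ.toFun t, h t⟩ : A)) '' C))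
    rw [Set.image_image]
    exact σ.cont C ⟨t, ht, rfl⟩
  · rw [chainMap_single]
    rfl

/-- Continuity in the sense of closure operators suffices to pull back neighbourhoods, although the
interior operator of `X` need not be idempotent. -/
theorem preimage_int_subset {n : ℕ} (σ : SingularSimplex X n) (A : Set X) :
    σ.toFun ⁻¹' int A ⊆ interior (σ.toFun ⁻¹' A) := by
  intro t ht
  rw [interior_eq_compl_closure_compl]
  intro h
  refine ht (cl_mono ?_ (σ.cont _ ⟨t, h, rfl⟩))
  rintro _ ⟨s, hs, rfl⟩
  exact hs

theorem subdiv_pow_realize {n k : ℕ} (σ : SingularSimplex X n)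
    (c : LinChains (stdSimplex ℝ (Fin (n + 1))) (k + 1)) (m : ℕ) :
    (subdiv X k ^ m) (realize σ k c) = realize σ k ((linSubdiv (bary n) (k + 1) ^ m) c) := by
  induction m with
  | zero => rfl
  | succ m ih =>
    rw [pow_succ', pow_succ', Module.End.mul_apply, Module.End.mul_apply, ih, subdiv_realize]

theorem exists_subdiv_pow_single_mem {A B : Set X} (hAB : ∀ x, x ∈ int A ∨ x ∈ int B) {n : ℕ}
    (σ : SingularSimplex X n) :
    ∃ m : ℕ, (subdiv X n ^ m) (Finsupp.single σ 1) ∈ smallChains A B n := by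
  let U : Bool → Set X := fun b => if b then A else B
  obtain ⟨δ, hδ, hball⟩ := lebesgue_number_lemma_of_metric
    (c := fun b => interior (σ.toFun ⁻¹' U b))
    (isCompact_univ (X := stdSimplex ℝ (Fin (n + 1)))) (fun _ => isOpen_interior) fun t _ => by
      rcases hAB (σ.toFun t) with h | h
      · exact Set.mem_iUnion.2 ⟨true, preimage_int_subset σ _ h⟩
      · exact Set.mem_iUnion.2 ⟨false, preimage_int_subset σ _ h⟩
  -- The Lebesgue number lemma gives open balls, and mesh bounds give closed ones: hence `δ / 2`.
  obtain ⟨m, hm⟩ := exists_linSubdiv_pow_mem_smallTuples n (half_pos hδ)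
  refine ⟨m, ?_⟩
  rw [← realize_vertices, subdiv_pow_realize]
  refine map_mem_of_mem_supported _ (fun v hv => ?_) hm
  rw [realize_single]
  obtain ⟨b, hb⟩ := hball (v 0) (Set.mem_univ _)
  have hU : ∀ t, (σ.restrict v).toFun t ∈ U b := fun t =>
    interior_subset (s := σ.toFun ⁻¹' U b)
      (hb ((affineMap_mem_closedBall (fun i => hv i 0) t).trans_lt (half_lt_self hδ)))
  cases b with
  | true => exact Submodule.mem_sup_left (single_mem_subChains hU)
  | false => exact Submodule.mem_sup_right (single_mem_subChains hU)

/-- If `i(A) ∪ i(B) = X`, every chain becomes small after finitely many subdivisions. -/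
theorem exists_subdiv_pow_mem {A B : Set X} (hAB : ∀ x, x ∈ int A ∨ x ∈ int B) {n : ℕ}
    (c : Chains X n) : ∃ m : ℕ, (subdiv X n ^ m) c ∈ smallChains A B n := by
  induction c using Finsupp.induction_linear with
  | zero => exact ⟨0, Submodule.zero_mem _⟩
  | add c d hc hd =>
    obtain ⟨p, hp⟩ := hc
    obtain ⟨q, hq⟩ := hd
    refine ⟨p + q, ?_⟩
    rw [map_add]
    refine Submodule.add_mem _ ?_ ?_
    · rw [add_comm p q, pow_add]
      exact subdiv_pow_mem_smallChains hp q
    · rw [pow_add]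
      exact subdiv_pow_mem_smallChains hq p
  | single σ a =>
    obtain ⟨m, hm⟩ := exists_subdiv_pow_single_mem hAB σ
    refine ⟨m, ?_⟩
    rw [← mul_one a, ← smul_eq_mul, ← Finsupp.smul_single, map_smul]
    exact Submodule.smul_mem _ _ hm

/-- Every `0`-chain differs from a small one by a boundary. -/
theorem exists_sub_boundary_mem_smallChains_zero {A B : Set X}
    (hAB : ∀ x, x ∈ int A ∨ x ∈ int B) (z : Chains X 0) :
    ∃ w, z - boundary X 0 w ∈ smallChains A B 0 := by
  have h : ∀ m : ℕ, ∃ w, z - boundary X 0 w = (subdiv X 0 ^ m) z := fun m => by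
    induction m with
    | zero => exact ⟨0, by rw [map_zero, sub_zero]; rfl⟩
    | succ m ih =>
      obtain ⟨w, hw⟩ := ih
      refine ⟨w + subdivHomotopy X 0 ((subdiv X 0 ^ m) z), ?_⟩
      rw [map_add, boundary_subdivHomotopy_zero, ← sub_sub, hw, sub_sub_cancel, pow_succ',
        Module.End.mul_apply]
  obtain ⟨m, hm⟩ := exists_subdiv_pow_mem hAB z
  obtain ⟨w, hw⟩ := h m
  exact ⟨w, hw ▸ hm⟩

theorem boundary_subdiv_pow {n : ℕ} (c : Chains X (n + 1)) (m : ℕ) :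
    boundary X n ((subdiv X (n + 1) ^ m) c) = (subdiv X n ^ m) (boundary X n c) := by
  induction m with
  | zero => rfl
  | succ m ih =>
    rw [pow_succ', pow_succ', Module.End.mul_apply, Module.End.mul_apply, boundary_subdiv, ih]

/-- A chain whose boundary is small differs from a small chain by a boundary: a subdivision step
changes `z` by `∂Tz + T∂z`, and `T` preserves small chains. -/
theorem exists_sub_boundary_mem_smallChains_succ {A B : Set X}
    (hAB : ∀ x, x ∈ int A ∨ x ∈ int B) {n : ℕ} (z : Chains X (n + 1))
    (hz : boundary X n z ∈ smallChains A B n) :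
    ∃ w, z - boundary X (n + 1) w ∈ smallChains A B (n + 1) := by
  have h : ∀ m : ℕ, ∃ w, z - boundary X (n + 1) w - (subdiv X (n + 1) ^ m) z ∈
      smallChains A B (n + 1) := fun m => by
    induction m with
    | zero =>
      refine ⟨0, ?_⟩
      rw [map_zero, sub_zero, pow_zero, Module.End.one_apply, sub_self]
      exact Submodule.zero_mem _
    | succ m ih =>
      obtain ⟨w, hw⟩ := ih
      refine ⟨w + subdivHomotopy X (n + 1) ((subdiv X (n + 1) ^ m) z), ?_⟩
      have h1 := subdivHomotopy_mem_smallChains (subdiv_pow_mem_smallChains hz m)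
      rw [← boundary_subdiv_pow] at h1
      rw [map_add, boundary_subdivHomotopy_succ, pow_succ', Module.End.mul_apply]
      convert Submodule.add_mem _ hw h1 using 1
      abel
  obtain ⟨m, hm⟩ := exists_subdiv_pow_mem hAB z
  obtain ⟨w, hw⟩ := h m
  exact ⟨w, by simpa only [sub_add_cancel] using Submodule.add_mem _ hw hm⟩

end Singular

/-! ### Quasi-isomorphisms of complexes of modules -/

/-- A map of short complexes of modules induces an isomorphism on homology if cycles that become
boundaries are boundaries, and every cycle of the target is homologous to the image of a cycle. -/
theorem isIso_homologyMap_of_elements {R : Type*} [Ring R] {S T : ShortComplex (ModuleCat.{u} R)}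
    (φ : S ⟶ T)
    (hinj : ∀ z : S.X₂, S.g z = 0 → (∃ w : T.X₁, T.f w = φ.τ₂ z) → ∃ w : S.X₁, S.f w = z)
    (hsurj : ∀ z : T.X₂, T.g z = 0 → ∃ y : S.X₂, S.g y = 0 ∧ ∃ w : T.X₁, z - T.f w = φ.τ₂ y) :
    IsIso (ShortComplex.homologyMap φ) := by
  have hπ : ∀ (U : ShortComplex (ModuleCat.{u} R)) (z : U.cycles),
      U.homologyι (U.homologyπ z) = U.pOpcycles (U.iCycles z) := fun U z => by
    rw [← ConcreteCategory.comp_apply, ← ConcreteCategory.comp_apply, U.homology_π_ι]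
  have hι : ∀ U : ShortComplex (ModuleCat.{u} R), Function.Injective U.homologyι := fun U =>
    (ModuleCat.mono_iff_injective _).1 inferInstance
  have hmap : ∀ z : S.cycles, ShortComplex.homologyMap φ (S.homologyπ z) =
      T.homologyπ (ShortComplex.cyclesMap φ z) := fun z => by
    rw [← ConcreteCategory.comp_apply, ← ConcreteCategory.comp_apply,
      ShortComplex.homologyπ_naturality]
  have hi : ∀ z : S.cycles, T.iCycles (ShortComplex.cyclesMap φ z) = φ.τ₂ (S.iCycles z) :=
    fun z => by
      rw [← ConcreteCategory.comp_apply, ← ConcreteCategory.comp_apply, ShortComplex.cyclesMap_i]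
  have hg : ∀ (U : ShortComplex (ModuleCat.{u} R)) (z : U.cycles), U.g (U.iCycles z) = 0 :=
    fun U z => by
      rw [← ConcreteCategory.comp_apply, U.iCycles_g]
      rfl
  rw [ConcreteCategory.isIso_iff_bijective]
  constructor
  · change Function.Injective (ShortComplex.homologyMap φ).hom
    rw [injective_iff_map_eq_zero]
    intro x hx
    obtain ⟨z, rfl⟩ := (ModuleCat.epi_iff_surjective S.homologyπ).1 inferInstance x
    change ShortComplex.homologyMap φ (S.homologyπ z) = 0 at hx
    rw [hmap] at hx
    have h1 := hπ T (ShortComplex.cyclesMap φ z)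
    rw [hx, map_zero, hi, eq_comm, ShortComplex.moduleCat_pOpcycles_eq_zero_iff] at h1
    obtain ⟨w, hw⟩ := hinj _ (hg S z) h1
    apply hι S
    rw [hπ, map_zero, ShortComplex.moduleCat_pOpcycles_eq_zero_iff]
    exact ⟨w, hw⟩
  · intro x
    obtain ⟨z, rfl⟩ := (ModuleCat.epi_iff_surjective T.homologyπ).1 inferInstance x
    obtain ⟨y, hy, w, hw⟩ := hsurj _ (hg T z)
    refine ⟨S.homologyπ (S.moduleCatCyclesIso.inv ⟨y, hy⟩), ?_⟩
    apply hι T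
    rw [hmap, hπ, hπ, hi, ShortComplex.moduleCat_pOpcycles_eq_iff]
    have : S.iCycles (S.moduleCatCyclesIso.inv ⟨y, hy⟩) = y :=
      S.moduleCatCyclesIso_inv_iCycles_apply ⟨y, hy⟩
    rw [this, ← hw]
    exact ⟨-w, by rw [map_neg]; change - T.f w = _; abel⟩

/-- An injective chain map is a quasi-isomorphism if its cokernel is acyclic; `h0` and `hs` spell
out the acyclicity in terms of elements of the target. -/
theorem quasiIso_of_injective {K L : ChainComplex (ModuleCat.{u} ℤ) ℕ} (f : K ⟶ L)
    (hf : ∀ n, Function.Injective (f.f n))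
    (h0 : ∀ z : L.X 0, ∃ (w : L.X 1) (y : K.X 0), z - L.d 1 0 w = f.f 0 y)
    (hs : ∀ n, ∀ z : L.X (n + 1), (∃ y : K.X n, L.d (n + 1) n z = f.f n y) →
      ∃ (w : L.X (n + 2)) (y : K.X (n + 1)), z - L.d (n + 2) (n + 1) w = f.f (n + 1) y) :
    QuasiIso f := by
  have hcomm : ∀ n (y : K.X (n + 1)), f.f n (K.d (n + 1) n y) = L.d (n + 1) n (f.f (n + 1) y) :=
    fun n y => by
      rw [← ConcreteCategory.comp_apply, ← ConcreteCategory.comp_apply, f.comm]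
  have hdd : ∀ n (w : L.X (n + 2)), L.d (n + 1) n (L.d (n + 2) (n + 1) w) = 0 := fun n w => by
    rw [← ConcreteCategory.comp_apply, L.d_comp_d]
    rfl
  have hinj : ∀ n (z : K.X n), (∃ w : L.X (n + 1), L.d (n + 1) n w = f.f n z) →
      ∃ w : K.X (n + 1), K.d (n + 1) n w = z := by
    rintro n z ⟨w, hw⟩
    obtain ⟨w', y, hy⟩ := hs n w ⟨z, hw⟩
    refine ⟨y, hf n ?_⟩
    rw [hcomm, ← hy, map_sub, hdd, sub_zero, hw]
  have hsurj : ∀ n (z : L.X (n + 1)), L.d (n + 1) n z = 0 →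
      ∃ y : K.X (n + 1), K.d (n + 1) n y = 0 ∧
        ∃ w : L.X (n + 2), z - L.d (n + 2) (n + 1) w = f.f (n + 1) y := fun n z hz => by
    obtain ⟨w, y, h⟩ := hs n z ⟨0, by rw [map_zero, hz]⟩
    refine ⟨y, hf n ?_, w, h⟩
    rw [hcomm, ← h, map_sub, hdd, sub_zero, hz, map_zero]
  refine ⟨fun n => ?_⟩
  cases n with
  | zero =>
    rw [quasiIsoAt_iff' f 1 0 0 (by simp) (by simp), ShortComplex.quasiIso_iff]
    refine isIso_homologyMap_of_elements _ (fun z _ hz => hinj 0 z hz) fun z _ => ?_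
    obtain ⟨w, y, h⟩ := h0 z
    refine ⟨y, ?_, w, h⟩
    change K.d 0 0 y = 0
    rw [K.shape 0 0 (by simp)]
    rfl
  | succ n =>
    rw [quasiIsoAt_iff' f (n + 2) (n + 1) n (by simp) (by simp), ShortComplex.quasiIso_iff]
    exact isIso_homologyMap_of_elements _ (fun z _ hz => hinj _ z hz) (hsurj n)

/-! ### Excision -/

section Excision

variable {X : Type u} [ClosureSpace X]

theorem subChains_eq_supported (A : Set X) (n : ℕ) :
    subChains A n = Finsupp.supported ℤ ℤ {σ : SingularSimplex X n | ∀ t, σ.toFun t ∈ A} := by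
  apply le_antisymm
  · rintro _ ⟨c, rfl⟩
    refine map_mem_of_mem_supported (s := Set.univ) _ (fun σ _ => ?_) (Set.subset_univ _)
    rw [chainMap_single]
    exact Finsupp.single_mem_supported ℤ 1 fun t => (σ.toFun t).2
  · intro c hc
    exact map_mem_of_mem_supported LinearMap.id (fun σ hσ => single_mem_subChains hσ) hc

theorem push_val_injective (S : Set X) (n : ℕ) : Function.Injective
    fun σ : SingularSimplex S n => σ.push Subtype.val (isCont_val S) := by
  intro σ τ h
  ext t
  exact congrFun (congrArg SingularSimplex.toFun h) t

theorem mem_subChains_of_chainMap_val_mem {S T : Set X} {n : ℕ} {c : Chains S n}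
    (hc : chainMap Subtype.val (isCont_val S) n c ∈ subChains T n) :
    c ∈ subChains (Subtype.val ⁻¹' T : Set S) n := by
  classical
  rw [subChains_eq_supported, Finsupp.mem_supported] at hc ⊢
  rw [chainMap, Finsupp.lmapDomain_apply,
    Finsupp.mapDomain_support_of_injective (push_val_injective S n)] at hc
  intro σ hσ t
  exact hc (Finset.mem_coe.2 (Finset.mem_image_of_mem _ hσ)) t

/-- The relative chain map is injective because `C_n(A) ∩ C_n(B) = C_n(A ∩ B)`. -/
theorem relChainMap_inclusion_injective (A B : Set X) (n : ℕ) : Function.Injective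
    (relChainMap (inclusion B (Set.inter_subset_left : A ∩ B ⊆ A)) n) := by
  rw [injective_iff_map_eq_zero]
  intro x hx
  obtain ⟨c, rfl⟩ := Submodule.mkQ_surjective _ x
  rw [relChainMap, Submodule.mkQ_apply, Submodule.mapQ_apply, Submodule.Quotient.mk_eq_zero] at hx
  rw [Submodule.mkQ_apply, Submodule.Quotient.mk_eq_zero]
  have h := mem_subChains_of_chainMap_val_mem hx
  rwa [show (Subtype.val ⁻¹' A : Set B) = Subtype.val ⁻¹' (A ∩ B) from
    (Subtype.preimage_coe_inter_self B A).symm] at h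

/-- The image of `C_n(B, A ∩ B)` in `C_n(X, A)` consists of the classes of small chains. -/
theorem mk_mem_range_relChainMap_iff {A B : Set X} {n : ℕ} {c : Chains X n} :
    (∃ y, (Submodule.Quotient.mk c : RelChains A n) =
      relChainMap (inclusion B (Set.inter_subset_left : A ∩ B ⊆ A)) n y) ↔
    c ∈ smallChains A B n := by
  constructor
  · rintro ⟨y, hy⟩
    obtain ⟨b, rfl⟩ := Submodule.mkQ_surjective _ y
    rw [relChainMap, Submodule.mkQ_apply, Submodule.mapQ_apply, Submodule.Quotient.eq] at hy
    rw [← sub_add_cancel c (chainMap Subtype.val (isCont_val B) n b)]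
    exact Submodule.add_mem_sup hy ⟨b, rfl⟩
  · intro hc
    obtain ⟨a, ha, _, ⟨b, rfl⟩, rfl⟩ := Submodule.mem_sup.1 hc
    refine ⟨Submodule.Quotient.mk b, ?_⟩
    rw [relChainMap, Submodule.mapQ_apply, Submodule.Quotient.eq]
    change a + chainMap Subtype.val (isCont_val B) n b - chainMap Subtype.val (isCont_val B) n b ∈ _
    rwa [add_sub_cancel_right]

theorem quasiIso_relComplexMap_inclusion {A B : Set X} (hAB : ∀ x, x ∈ int A ∨ x ∈ int B) :
    QuasiIso (relComplexMap (inclusion B (Set.inter_subset_left : A ∩ B ⊆ A))) := by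
  have hd : ∀ n, (relComplex A).d (n + 1) n = ModuleCat.ofHom (relBoundary A n) := fun n => by
    simp only [relComplex, ChainComplex.of_d]
  refine quasiIso_of_injective _ (relChainMap_inclusion_injective A B) (fun z => ?_)
    fun n z hz => ?_
  · rw [hd]
    obtain ⟨c, rfl⟩ := Submodule.mkQ_surjective _ z
    obtain ⟨w, hw⟩ := exists_sub_boundary_mem_smallChains_zero hAB c
    exact ⟨Submodule.Quotient.mk w, mk_mem_range_relChainMap_iff.2 hw⟩
  · rw [hd] at hz ⊢
    obtain ⟨c, rfl⟩ := Submodule.mkQ_surjective _ z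
    obtain ⟨w, hw⟩ := exists_sub_boundary_mem_smallChains_succ hAB c
      (mk_mem_range_relChainMap_iff.1 hz)
    exact ⟨Submodule.Quotient.mk w, mk_mem_range_relChainMap_iff.2 hw⟩

/-- Excision; the subset `T` is only propositionally equal to `A ∩ B`, so that both forms of the
theorem are instances. -/
theorem isIso_relHomologyMap_inclusion {A B T : Set X} (hAB : ∀ x, x ∈ int A ∨ x ∈ int B)
    (hT : T = A ∩ B) (h : T ⊆ A) (n : ℤ) : IsIso (relHomologyMap (inclusion B h) n) := by
  subst hT
  have := (HomologicalComplex.quasiIso_extendMap_iff _ natToInt).2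
    (quasiIso_relComplexMap_inclusion hAB)
  exact (quasiIsoAt_iff_isIso_homologyMap _ n).1 (this.quasiIsoAt n)

end Excision

end ClosureSpace

theorem mainTheorem3 {X : Type u} [ClosureSpace X] :
    (∀ A B : Set X, ClosureSpace.IsInteriorCover {A, B} →
      ∀ n : ℤ, IsIso (ClosureSpace.relHomologyMap
        (ClosureSpace.inclusion B (Set.inter_subset_left : A ∩ B ⊆ A)) n)) ∧
    (∀ Z A : Set X, Z ⊆ A → ClosureSpace.cl Z ⊆ ClosureSpace.int A →
      ∀ n : ℤ, IsIso (ClosureSpace.relHomologyMap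
        (ClosureSpace.inclusion (Set.univ \ Z) (Set.sdiff_subset : A \ Z ⊆ A)) n)) := by
  refine ⟨fun A B hAB n => ?_, fun Z A _ hZA n => ?_⟩
  · refine ClosureSpace.isIso_relHomologyMap_inclusion (fun x => ?_) rfl _ n
    obtain ⟨U, rfl | rfl, hx⟩ := hAB.2 x
    · exact Or.inl hx
    · exact Or.inr hx
  -- With `B = X \ Z`, the condition `c(Z) ⊆ i(A)` says that `i(A)` and `i(B)` cover `X`.
  · refine ClosureSpace.isIso_relHomologyMap_inclusion (fun x => ?_) ?_ _ n
    · by_cases hx : x ∈ ClosureSpace.cl Z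
      · exact Or.inl (hZA hx)
      · right
        rwa [ClosureSpace.int, ← Set.compl_eq_univ_sdiff, compl_compl]
    · rw [← Set.compl_eq_univ_sdiff, Set.sdiff_eq]
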